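/- Let $(S_n)_{n\in\mathbb Z}$ and $(T_n)_{n\in\mathbb Z}$ be the two sequences of rational numbers that are generated by the Somos-5 recurrence $$\tau_{n+5}\tau_n=\tau_{n+4}\tau_{n+1}+\tau_{n+3}\tau_{n+2},$$ where $(S_0,S_1,S_2,S_3,S_4)=(1,1,1,2,3)$ and $S_{-n}=S_n$, while $T_0=0$, $(T_1,T_2,T_3,T_4,T_5)=(1,-1,1,1,-7)$ and $T_{-n}=-T_n$. (Thus $(S_n)_{n\ge 0}$ is $1,1,1,2,3,5,11,37,83,274,\ldots$ and $(T_n)_{n\ge 0}$ is $0,1,-1,1,1,-7,8,-1,-57,391,\ldots$.) For $(X_n)=(S_n)$ and for $(X_n)=(T_n)$ the following holds. (a) For all $j,n\in\mathbb Z$, $$D_X(j,n):=\left|\begin{array}{ccc} X_{n-1}T_0 & X_nT_1 & X_{n+j-1}T_j\\ X_{n+j-1}T_{-j} & X_{n+j}T_{-j+1} & X_{n+2j-1}T_0\\ X_{n+j+1}T_{-j-2} & X_{n+j+2}T_{-j-1} & X_{n+2j+1}T_{-2} \end{array}\right|=0 .$$ (b) For all $j,n\in\mathbb Z$, $$D_X(j,n)=X_{n+j-1}T_j\bigl(T_jT_{j+1}X_{n+j+2}X_{n+j-1}-T_{j-1}T_{j+2}X_{n+j+1}X_{n+j}-T_1T_2X_{n+2j+1}X_n\bigr),$$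 and $D_X(j,n)=0$ is equivalent to the higher Somos relation $$T_1T_2X_{n+2j+1}X_n=T_jT_{j+1}X_{n+j+2}X_{n+j-1}-T_{j-1}T_{j+2}X_{n+j+1}X_{n+j}.$$ These relations hold for all $j,n\in\mathbb Z$. (c) More generally, for every $n\in\mathbb Z$, every minor of size $k\times k$ with $k\ge 3$ of the infinite matrix $(X_{n+2i+j}T_{-2i+j})_{(i,j)\in\mathbb Z^2}$ vanishes; that is, $\det\bigl(X_{n+2i_a+j_b}T_{-2i_a+j_b}\bigr)_{1\le a,b\le k}=0$ for all $i_1,\ldots,i_k,j_1,\ldots,j_k\in\mathbb Z$. -/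

import Mathlib

/-- The solution `τ₀, τ₁, τ₂, …` of the Somos-5 recurrence
`τ_{n+5} τ_n = τ_{n+4} τ_{n+1} + τ_{n+3} τ_{n+2}` with given initial values `τ₀, …, τ₄`. -/
def somosFive (a b c d e : ℚ) : ℕ → ℚ
  | 0 => a
  | 1 => b
  | 2 => c
  | 3 => d
  | 4 => e
  | n + 5 =>
    (somosFive a b c d e (n + 4) * somosFive a b c d e (n + 1)
      + somosFive a b c d e (n + 3) * somosFive a b c d e (n + 2)) / somosFive a b c d e n

/-- The Somos-5 sequence `1, 1, 1, 2, 3, 5, 11, 37, 83, 274, …` (listed from index `0`),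
extended to negative indices by `S_{-n} = S_n`. -/
def somosS : ℤ → ℚ
  | .ofNat n => somosFive 1 1 1 2 3 n
  | .negSucc n => somosFive 1 1 1 2 3 (n + 1)

/-- The Somos-5 sequence `0, 1, -1, 1, 1, -7, 8, -1, -57, 391, …` (listed from index `0`),
extended to negative indices by `T_{-n} = -T_n`. As `T₀ = 0`, the recurrence cannot produce `T₅`
from `T₀, …, T₄`, so it is started from the five values `T₁, …, T₅ = 1, -1, 1, 1, -7`. -/
def somosT : ℤ → ℚ
  | .ofNat 0 => 0
  | .ofNat (n + 1) => somosFive 1 (-1) 1 1 (-7) n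
  | .negSucc n => -somosFive 1 (-1) 1 1 (-7) n

/-- The infinite matrix with entry `X_{n+2i+j} T_{-2i+j}` in row `i` and column `j`. -/
def somosMatrix (X : ℤ → ℚ) (n : ℤ) : Matrix ℤ ℤ ℚ :=
  Matrix.of fun i j => X (n + 2 * i + j) * somosT (-2 * i + j)

/-- The `3 × 3` matrix attached to `j` and `n`. -/
def somosMatrixThree (X : ℤ → ℚ) (j n : ℤ) : Matrix (Fin 3) (Fin 3) ℚ :=
  !![X (n - 1) * somosT 0, X n * somosT 1, X (n + j - 1) * somosT j;
     X (n + j - 1) * somosT (-j), X (n + j) * somosT (-j + 1), X (n + 2 * j - 1) * somosT 0;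
     X (n + j + 1) * somosT (-j - 2), X (n + j + 2) * somosT (-j - 1),
       X (n + 2 * j + 1) * somosT (-2)]

/-- The higher Somos relation `T₁T₂ X_{n+2j+1} X_n
= T_j T_{j+1} X_{n+j+2} X_{n+j-1} - T_{j-1} T_{j+2} X_{n+j+1} X_{n+j}`. -/
def HigherSomos (X : ℤ → ℚ) (j n : ℤ) : Prop :=
  somosT 1 * somosT 2 * X (n + 2 * j + 1) * X n =
    somosT j * somosT (j + 1) * X (n + j + 2) * X (n + j - 1)
      - somosT (j - 1) * somosT (j + 2) * X (n + j + 1) * X (n + j)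

/-! Besides Somos-5, both sequences satisfy a Somos-4 relation whose coefficient alternates between
`α` and `β`, with `α * β = 6`, and a cubic relation with coefficient `5`. These shared constants
imply, by induction on `d`, that each product `X (m + d) * X (m - d)` (`m`, `d` both integers or
both half-integers) is a combination of two products depending on `m`, with coordinates in `T`
depending on `d`; for integer `d` its parity is fixed. These are `OddRelation` and `EvenRelation`;
the higher Somos relations are a reindexing of the former.

For `X = T` the same relations say that products of two values of `T` are the 2×2 determinants of
the coordinate vectors. Three vectors in a plane are dependent, which gives three-term relations,
that is, a linear relation among any three rows of the matrix with coefficients independent of the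
column.

The obstacle is `T n ≠ 0` for `n ≠ 0`, since both the recurrence and the induction divide. Relations
for `T` are therefore first proved on a window with nonvanishing as hypothesis. They yield
division-free duplication formulas, which extend integrality, residues modulo 2 and 7, and hence
nonvanishing, to the next index. -/

/-- The `2`-periodic sequence with value `α` at even and `β` at odd integers. -/
def alternating (α β : ℚ) (m : ℤ) : ℚ := if Even m then α else β

theorem alternating_even {α β : ℚ} {m : ℤ} (h : Even m) : alternating α β m = α := if_pos h

theorem alternating_odd {α β : ℚ} {m : ℤ} (h : Odd m) : alternating α β m = β :=
  if_neg (Int.not_even_iff_odd.mpr h)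

theorem alternating_add_two (α β : ℚ) (m : ℤ) :
    alternating α β (m + 2) = alternating α β m := by
  simp [alternating]

theorem alternating_sub_one (α β : ℚ) (m : ℤ) :
    alternating α β (m - 1) = alternating α β (m + 1) := by
  rw [← alternating_add_two α β (m - 1)]; ring_nf

theorem alternating_neg (α β : ℚ) (m : ℤ) : alternating α β (-m) = alternating α β m := by
  simp [alternating]

/-! ### Propagation of the Somos-4 and cubic relations -/

/-- Somos-5 relations, Somos-4 relations with alternating coefficient and cubic invariants of a
sequence, on the window `[-N, N]`. -/
structure SomosOn (X : ℤ → ℚ) (α β : ℚ) (N : ℤ) : Prop where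
  five : ∀ k, -N ≤ k → k + 5 ≤ N →
    X (k + 5) * X k = X (k + 4) * X (k + 1) + X (k + 3) * X (k + 2)
  four : ∀ m, -N ≤ m - 2 → m + 2 ≤ N →
    X (m + 2) * X (m - 2) = alternating α β m * X (m + 1) * X (m - 1) - X m ^ 2
  cubic : ∀ m, -N ≤ m - 2 → m + 2 ≤ N →
    X (m + 2) * X (m - 1) ^ 2 + X (m - 2) * X (m + 1) ^ 2
      = 5 * X (m + 1) * X m * X (m - 1) - alternating α β (m + 1) * X m ^ 3

theorem five_of_nonneg {X : ℤ → ℚ} {ε : ℚ} {N : ℤ} (hε : ε = 1 ∨ ε = -1)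
    (hX : ∀ n, X (-n) = ε * X n)
    (h : ∀ k, -2 ≤ k → k + 5 ≤ N →
      X (k + 5) * X k = X (k + 4) * X (k + 1) + X (k + 3) * X (k + 2))
    (k : ℤ) (h1 : -N ≤ k) (h2 : k + 5 ≤ N) :
    X (k + 5) * X k = X (k + 4) * X (k + 1) + X (k + 3) * X (k + 2) := by
  -- The relation is invariant under `k ↦ -5 - k`, which sends `k < -2` to `k ≥ -2`.
  by_cases hk : -2 ≤ k
  · exact h k hk h2
  have e := h (-k - 5) (by omega) (by omega)
  rw [show -k - 5 + 5 = -k by ring, show -k - 5 = -(k + 5) by ring,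
    show -(k + 5) + 4 = -(k + 1) by ring, show -(k + 5) + 1 = -(k + 4) by ring,
    show -(k + 5) + 3 = -(k + 2) by ring, show -(k + 5) + 2 = -(k + 3) by ring] at e
  simp only [hX] at e
  rcases hε with rfl | rfl <;> linear_combination e

/-- By Somos-5, `X (m - 1)` times the defect at `m + 2` is `X (m + 3)` times the defect at `m`. -/
theorem four_step {X : ℤ → ℚ} {α β : ℚ} {m : ℤ}
    (h0 : X (m - 1) ≠ 0)
    (f1 : X (m - 1 + 5) * X (m - 1) = X (m - 1 + 4) * X (m - 1 + 1) + X (m - 1 + 3) * X (m - 1 + 2))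
    (f2 : X (m - 2 + 5) * X (m - 2) = X (m - 2 + 4) * X (m - 2 + 1) + X (m - 2 + 3) * X (m - 2 + 2))
    (h : X (m + 2) * X (m - 2) = alternating α β m * X (m + 1) * X (m - 1) - X m ^ 2) :
    X (m + 2 + 2) * X (m + 2 - 2)
      = alternating α β (m + 2) * X (m + 2 + 1) * X (m + 2 - 1) - X (m + 2) ^ 2 := by
  rw [alternating_add_two]
  ring_nf at f1 f2 h h0 ⊢
  apply mul_right_cancel₀ h0
  linear_combination X m * f1 - X (2 + m) * f2 + X (3 + m) * h

/-- By the Somos-4 relations, `X (m - 1)` times the defect at `m + 1` is `X (m + 2)` times the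
defect at `m`. -/
theorem cubic_step {X : ℤ → ℚ} {α β : ℚ} {m : ℤ} (h0 : X (m - 1) ≠ 0)
    (k1 : X (m + 2) * X (m - 2) = alternating α β m * X (m + 1) * X (m - 1) - X m ^ 2)
    (k2 : X (m + 1 + 2) * X (m + 1 - 2)
      = alternating α β (m + 1) * X (m + 1 + 1) * X (m + 1 - 1) - X (m + 1) ^ 2)
    (h : X (m + 2) * X (m - 1) ^ 2 + X (m - 2) * X (m + 1) ^ 2
      = 5 * X (m + 1) * X m * X (m - 1) - alternating α β (m + 1) * X m ^ 3) :
    X (m + 1 + 2) * X (m + 1 - 1) ^ 2 + X (m + 1 - 2) * X (m + 1 + 1) ^ 2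
      = 5 * X (m + 1 + 1) * X (m + 1) * X (m + 1 - 1)
        - alternating α β (m + 1 + 1) * X (m + 1) ^ 3 := by
  rw [show m + 1 + 1 = m + 2 by ring, alternating_add_two]
  ring_nf at k1 k2 h h0 ⊢
  apply mul_right_cancel₀ h0
  linear_combination X m ^ 2 * k2 - X (1 + m) ^ 2 * k1 + X (2 + m) * h

theorem SomosOn.of_initial {X : ℤ → ℚ} {α β ε : ℚ} {N : ℤ} (hε : ε = 1 ∨ ε = -1)
    (hX : ∀ n, X (-n) = ε * X n) (h0 : ∀ n, 0 < n → n ≤ N - 4 → X n ≠ 0)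
    (h5 : ∀ k, -2 ≤ k → k + 5 ≤ N →
      X (k + 5) * X k = X (k + 4) * X (k + 1) + X (k + 3) * X (k + 2))
    (h4 : ∀ m, 0 ≤ m → m < 4 →
      X (m + 2) * X (m - 2) = alternating α β m * X (m + 1) * X (m - 1) - X m ^ 2)
    (h3 : ∀ m, 0 ≤ m → m < 3 →
      X (m + 2) * X (m - 1) ^ 2 + X (m - 2) * X (m + 1) ^ 2
        = 5 * X (m + 1) * X m * X (m - 1) - alternating α β (m + 1) * X m ^ 3) :
    SomosOn X α β N := by
  have five := five_of_nonneg hε hX h5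
  have four_nonneg : ∀ k : ℕ, ∀ m : ℤ, m = k → m + 2 ≤ N →
      X (m + 2) * X (m - 2) = alternating α β m * X (m + 1) * X (m - 1) - X m ^ 2 := by
    intro k
    induction k using Nat.strong_induction_on with
    | _ k ih =>
      intro m hm hN
      -- Starting the step at `m = 4` keeps the index of the divisor `X (m - 3)` positive, as `T 0 =
      -- 0`.
      by_cases hk : m < 4
      · exact h4 m (by omega) hk
      obtain ⟨l, rfl⟩ : ∃ l, m = l + 2 := ⟨m - 2, by ring⟩
      exact four_step (h0 _ (by omega) (by omega)) (h5 _ (by omega) (by omega))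
        (h5 _ (by omega) (by omega)) (ih (k - 2) (by omega) l (by omega) (by omega))
  have cubic_nonneg : ∀ k : ℕ, ∀ m : ℤ, m = k → m + 2 ≤ N →
      X (m + 2) * X (m - 1) ^ 2 + X (m - 2) * X (m + 1) ^ 2
        = 5 * X (m + 1) * X m * X (m - 1) - alternating α β (m + 1) * X m ^ 3 := by
    intro k
    induction k using Nat.strong_induction_on with
    | _ k ih =>
      intro m hm hN
      by_cases hk : m < 3
      · exact h3 m (by omega) hk
      obtain ⟨l, rfl⟩ : ∃ l, m = l + 1 := ⟨m - 1, by ring⟩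
      exact cubic_step (h0 _ (by omega) (by omega))
        (four_nonneg (k - 1) _ (by omega) (by omega)) (four_nonneg k _ (by omega) (by omega))
        (ih (k - 1) (by omega) l (by omega) (by omega))
  refine ⟨five, fun m h1 h2 => ?_, fun m h1 h2 => ?_⟩
  · rcases le_total 0 m with hm | hm
    · exact four_nonneg m.toNat m (by omega) h2
    have e := four_nonneg (-m).toNat (-m) (by omega) (by omega)
    rw [show -m + 2 = -(m - 2) by ring, show -m - 2 = -(m + 2) by ring,
      show -m + 1 = -(m - 1) by ring, show -m - 1 = -(m + 1) by ring, alternating_neg] at e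
    simp only [hX] at e
    rcases hε with rfl | rfl <;> linear_combination e
  · rcases le_total 0 m with hm | hm
    · exact cubic_nonneg m.toNat m (by omega) h2
    have e := cubic_nonneg (-m).toNat (-m) (by omega) (by omega)
    rw [show -m + 2 = -(m - 2) by ring, show -m - 2 = -(m + 2) by ring,
      show -m + 1 = -(m - 1) by ring, show -m - 1 = -(m + 1) by ring, alternating_neg,
      alternating_sub_one] at e
    simp only [hX] at e
    rcases hε with rfl | rfl
    · linear_combination e
    · linear_combination -e

/-- Eliminating `α` and `β` leaves only the constant `5`, common to `S` and `T`. -/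
theorem SomosOn.quartic {X : ℤ → ℚ} {α β : ℚ} {N : ℤ} (h : SomosOn X α β N) (n : ℤ)
    (h1 : -N ≤ n - 2) (h2 : n + 3 ≤ N) :
    X (n + 3) * X n ^ 2 * X (n - 1) + X (n + 2) * X (n + 1) ^ 2 * X (n - 2)
      = 5 * X (n + 2) * X (n - 1) * X (n + 1) * X n - X (n + 2) ^ 2 * X (n - 1) ^ 2
        - X (n + 1) ^ 2 * X n ^ 2 := by
  have k := h.four (n + 1) (by omega) (by omega)
  have c := h.cubic n h1 (by omega)
  ring_nf at k c ⊢
  linear_combination X n ^ 2 * k + X (2 + n) * c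

/-! ### Initial values and basic relations of `S` and `T` -/

theorem somosFive_rec (a b c d e : ℚ) (n : ℕ) : somosFive a b c d e (n + 5) =
    (somosFive a b c d e (n + 4) * somosFive a b c d e (n + 1)
      + somosFive a b c d e (n + 3) * somosFive a b c d e (n + 2)) / somosFive a b c d e n := by
  rw [somosFive]

theorem somosS_natCast (n : ℕ) : somosS n = somosFive 1 1 1 2 3 n := rfl

theorem somosT_natCast_succ (n : ℕ) : somosT (n + 1 : ℕ) = somosFive 1 (-1) 1 1 (-7) n := rfl

theorem somosS_neg (n : ℤ) : somosS (-n) = somosS n := by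
  rcases n with (_ | n) | n <;> rfl

theorem somosT_zero : somosT 0 = 0 := rfl

theorem somosT_neg (n : ℤ) : somosT (-n) = -somosT n := by
  rcases n with (_ | n) | n
  · exact neg_zero.symm
  · rfl
  · exact (neg_neg _).symm

theorem somosT_one : somosT 1 = 1 := by
  change somosFive 1 (-1) 1 1 (-7) 0 = _; rw [somosFive]

theorem somosT_two : somosT 2 = -1 := by
  change somosFive 1 (-1) 1 1 (-7) 1 = _; rw [somosFive]

theorem somosT_three : somosT 3 = 1 := by
  change somosFive 1 (-1) 1 1 (-7) 2 = _; rw [somosFive]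

theorem somosT_four : somosT 4 = 1 := by
  change somosFive 1 (-1) 1 1 (-7) 3 = _; rw [somosFive]

theorem somosT_five : somosT 5 = -7 := by
  change somosFive 1 (-1) 1 1 (-7) 4 = _; rw [somosFive]

theorem somosT_six : somosT 6 = 8 := by
  change somosFive 1 (-1) 1 1 (-7) 5 = _; simp only [somosFive]; norm_num

theorem somosS_zero : somosS 0 = 1 := by
  change somosFive 1 1 1 2 3 0 = _; rw [somosFive]

theorem somosS_one : somosS 1 = 1 := by
  change somosFive 1 1 1 2 3 1 = _; rw [somosFive]

theorem somosS_two : somosS 2 = 1 := by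
  change somosFive 1 1 1 2 3 2 = _; rw [somosFive]

theorem somosS_three : somosS 3 = 2 := by
  change somosFive 1 1 1 2 3 3 = _; rw [somosFive]

theorem somosS_four : somosS 4 = 3 := by
  change somosFive 1 1 1 2 3 4 = _; rw [somosFive]

theorem somosS_five : somosS 5 = 5 := by
  change somosFive 1 1 1 2 3 5 = _; simp only [somosFive]; norm_num

theorem somosFive_pos {a b c d e : ℚ} (ha : 0 < a) (hb : 0 < b) (hc : 0 < c) (hd : 0 < d)
    (he : 0 < e) (n : ℕ) : 0 < somosFive a b c d e n := by
  induction n using Nat.strong_induction_on with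
  | _ n ih =>
    match n, ih with
    | 0, _ | 1, _ | 2, _ | 3, _ | 4, _ => simpa [somosFive]
    | n + 5, ih =>
      rw [somosFive_rec]
      have h0 := ih n (by omega)
      have h1 := ih (n + 1) (by omega)
      have h2 := ih (n + 2) (by omega)
      have h3 := ih (n + 3) (by omega)
      have h4 := ih (n + 4) (by omega)
      positivity

theorem somosS_ne_zero (n : ℤ) : somosS n ≠ 0 := by
  rcases n with n | n <;>
  exact (somosFive_pos one_pos one_pos one_pos two_pos three_pos _).ne'

theorem somosS_five_of_nonneg (k : ℕ) : somosS ((k : ℤ) + 5) * somosS k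
    = somosS (k + 4) * somosS (k + 1) + somosS (k + 3) * somosS (k + 2) := by
  have h := somosFive_rec 1 1 1 2 3 k
  have h0 := somosS_ne_zero k
  rw [somosS_natCast] at h0
  rw [eq_div_iff h0] at h
  exact h

theorem somosT_five_of_pos (k : ℕ) (h0 : somosT (k + 1 : ℕ) ≠ 0) :
    somosT ((k : ℤ) + 1 + 5) * somosT (k + 1)
      = somosT (k + 1 + 4) * somosT (k + 1 + 1) + somosT (k + 1 + 3) * somosT (k + 1 + 2) := by
  have h := somosFive_rec 1 (-1) 1 1 (-7) k
  rw [somosT_natCast_succ] at h0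
  rw [eq_div_iff h0] at h
  exact h

theorem somosOn_somosS (N : ℤ) : SomosOn somosS 2 3 N := by
  refine .of_initial (ε := 1) (.inl rfl) (by simp [somosS_neg]) (fun n _ _ => somosS_ne_zero n)
    (fun k h1 _ => ?_) (fun m h1 h2 => ?_) (fun m h1 h2 => ?_)
  · rcases le_or_gt 0 k with hk | hk
    · lift k to ℕ using hk
      exact somosS_five_of_nonneg k
    interval_cases k <;> norm_num [somosS_neg, somosS_zero, somosS_one, somosS_two, somosS_three,
      somosS_four, somosS_five]
  all_goals
    interval_cases m <;> norm_num [somosS_neg, somosS_zero, somosS_one, somosS_two, somosS_three,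
      somosS_four, somosS_five, alternating, Int.even_iff]

theorem somosOn_somosT {N : ℤ} (h : ∀ n, 0 < n → n < N → somosT n ≠ 0) :
    SomosOn somosT 1 6 (N + 3) := by
  refine .of_initial (ε := -1) (.inr rfl) (by simp [somosT_neg])
    (fun n h1 h2 => h n h1 (by omega)) (fun k h1 h2 => ?_) (fun m h1 h2 => ?_)
    (fun m h1 h2 => ?_)
  · rcases le_or_gt 1 k with hk | hk
    · obtain ⟨l, rfl⟩ : ∃ l : ℕ, k = l + 1 := ⟨(k - 1).toNat, by omega⟩
      exact somosT_five_of_pos l (h _ (by omega) (by omega))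
    interval_cases k <;> norm_num [somosT_neg, somosT_zero, somosT_one, somosT_two, somosT_three,
      somosT_four, somosT_five]
  all_goals
    interval_cases m <;> norm_num [somosT_neg, somosT_zero, somosT_one, somosT_two, somosT_three,
      somosT_four, somosT_five, alternating, Int.even_iff]

/-! ### Products with odd index sum -/

/-- The relation expressing the product `X_{m+1+j} X_{m-j}` through `X_{m+2} X_{m-1}` and
`X_{m+1} X_m`. -/
def OddRelation (X : ℤ → ℚ) (j m : ℤ) : Prop :=
  X (m + 1 + j) * X (m - j) = somosT (j - 1) * somosT (j + 2) * (X (m + 1) * X m)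
    - somosT j * somosT (j + 1) * (X (m + 2) * X (m - 1))

theorem oddRelation_zero (X : ℤ → ℚ) (m : ℤ) : OddRelation X 0 m := by
  norm_num [OddRelation, somosT_neg, somosT_zero, somosT_one, somosT_two]

theorem oddRelation_one (X : ℤ → ℚ) (m : ℤ) : OddRelation X 1 m := by
  norm_num [OddRelation, somosT_zero, somosT_one, somosT_two, add_assoc]

/-- Relation `j + 1` at `m` is the product of relations `j` at `m + 1` and `m - 1`, divided by
relation `j - 1` at `m`. The right sides match because `u` and `t` satisfy identical Somos-5 and
quartic relations. -/
theorem oddRelation_step_algebra {u₀ u₁ u₂ u₃ u₄ u₅ t₀ t₁ t₂ t₃ t₄ t₅ p q r s : ℚ}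
    (u5 : u₅ * u₀ = u₄ * u₁ + u₃ * u₂) (t5 : t₅ * t₀ = t₄ * t₁ + t₃ * t₂)
    (uc : u₅ * u₂ ^ 2 * u₁ + u₄ * u₃ ^ 2 * u₀
      = 5 * u₄ * u₁ * u₃ * u₂ - u₄ ^ 2 * u₁ ^ 2 - u₃ ^ 2 * u₂ ^ 2)
    (tc : t₅ * t₂ ^ 2 * t₁ + t₄ * t₃ ^ 2 * t₀
      = 5 * t₄ * t₁ * t₃ * t₂ - t₄ ^ 2 * t₁ ^ 2 - t₃ ^ 2 * t₂ ^ 2)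
    (h1 : p * q = t₁ * t₄ * (u₄ * u₃) - t₂ * t₃ * (u₅ * u₂))
    (h2 : r * s = t₁ * t₄ * (u₂ * u₁) - t₂ * t₃ * (u₃ * u₀))
    (h3 : r * q = t₀ * t₃ * (u₃ * u₂) - t₁ * t₂ * (u₄ * u₁)) (h0 : r * q ≠ 0) :
    p * s = t₂ * t₅ * (u₃ * u₂) - t₃ * t₄ * (u₄ * u₁) := by
  apply mul_right_cancel₀ h0
  linear_combination r * s * h1 + (t₁ * t₄ * (u₄ * u₃) - t₂ * t₃ * (u₅ * u₂)) * h2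
    - (t₂ * t₅ * (u₃ * u₂) - t₃ * t₄ * (u₄ * u₁)) * h3
    + (t₂ * t₃) ^ 2 * (u₃ * u₂) * u5 - t₁ * t₂ * t₃ * t₄ * uc
    - t₂ * t₃ * (u₃ * u₂) ^ 2 * t5 + u₄ * u₁ * u₃ * u₂ * tc

theorem OddRelation.step {X : ℤ → ℚ} {α β : ℚ} {j m N M : ℤ} (hT : SomosOn somosT 1 6 N)
    (hX : SomosOn X α β M) (hj : -N ≤ j - 2 ∧ j + 3 ≤ N) (hm : -M ≤ m - 2 ∧ m + 3 ≤ M)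
    (h1 : OddRelation X j (m + 1)) (h2 : OddRelation X j (m - 1)) (h3 : OddRelation X (j - 1) m)
    (h0 : X (m + j) * X (m + 1 - j) ≠ 0) : OddRelation X (j + 1) m := by
  have t5 := hT.five (j - 2) (by omega) (by omega)
  have t4 := hT.quartic j hj.1 hj.2
  have x5 := hX.five (m - 2) (by omega) (by omega)
  have x4 := hX.quartic m hm.1 hm.2
  unfold OddRelation at *
  have e : X (m + 1 + (j + 1)) * X (m - (j + 1))
      = somosT j * somosT (j + 3) * (X (m + 1) * X m)
        - somosT (j + 1) * somosT (j + 2) * (X (m + 2) * X (m - 1)) :=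
    oddRelation_step_algebra (u₀ := X (m - 2)) (u₁ := X (m - 1)) (u₂ := X m) (u₃ := X (m + 1))
      (u₄ := X (m + 2)) (u₅ := X (m + 3)) (t₀ := somosT (j - 2)) (t₁ := somosT (j - 1))
      (t₂ := somosT j) (t₃ := somosT (j + 1)) (t₄ := somosT (j + 2)) (t₅ := somosT (j + 3))
      (q := X (m + 1 - j)) (r := X (m + j))
      (by linear_combination (norm := ring_nf) x5) (by linear_combination (norm := ring_nf) t5)
      x4 t4 (by linear_combination (norm := ring_nf) h1)
      (by linear_combination (norm := ring_nf) h2) (by linear_combination (norm := ring_nf) h3) h0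
  linear_combination (norm := ring_nf) e

/-- As `T` is odd, both sides change sign when `j` and `m` are swapped. This covers the cases where
the induction would divide by `T 0`. -/
theorem oddRelation_somosT_antisymm {j m : ℤ} (h : OddRelation somosT j m) :
    OddRelation somosT m j := by
  unfold OddRelation at *
  have e := somosT_neg (m - j)
  rw [neg_sub] at e
  rw [e, show j + 1 + m = m + 1 + j by ring]
  linear_combination -h

theorem oddRelation_somosT_reflect {j m : ℤ} (h : OddRelation somosT j m) :
    OddRelation somosT j (-1 - m) := by
  unfold OddRelation at *
  rw [show -1 - m + 1 + j = -(m - j) by ring, show -1 - m - j = -(m + 1 + j) by ring,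
    show -1 - m + 1 = -m by ring, show -1 - m = -(m + 1) by ring,
    show -(m + 1) + 2 = -(m - 1) by ring, show -(m + 1) - 1 = -(m + 2) by ring]
  simp only [somosT_neg]
  linear_combination h

theorem OddRelation.reflect_index {X : ℤ → ℚ} {j m : ℤ} (h : OddRelation X j m) :
    OddRelation X (-1 - j) m := by
  unfold OddRelation at *
  rw [show -1 - j - 1 = -(j + 2) by ring, show -1 - j + 2 = -(j - 1) by ring,
    show -1 - j + 1 = -j by ring, show -1 - j = -(j + 1) by ring,
    show m + 1 + -(j + 1) = m - j by ring, show m - -(j + 1) = m + 1 + j by ring]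
  simp only [somosT_neg]
  linear_combination h

theorem somosT_ne_zero_of_abs {N : ℤ} (h : ∀ n, 0 < n → n < N → somosT n ≠ 0) {n : ℤ}
    (h0 : n ≠ 0) (h1 : -N < n) (h2 : n < N) : somosT n ≠ 0 := by
  rcases lt_or_gt_of_ne h0 with h3 | h3
  · have := h (-n) (by omega) (by omega)
    rwa [somosT_neg, neg_ne_zero] at this
  · exact h n h3 h2

theorem oddRelation_somosT_of_window {N : ℤ} (h : ∀ n, 0 < n → n < N → somosT n ≠ 0) (k : ℕ) :
    (∀ m : ℤ, -N ≤ m - k → m + 1 + k ≤ N → OddRelation somosT k m) ∧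
    (∀ m : ℤ, -N ≤ m - (k + 1) → m + 1 + (k + 1) ≤ N → OddRelation somosT (k + 1) m) := by
  have hT := somosOn_somosT h
  induction k with
  | zero =>
    exact ⟨fun m _ _ => oddRelation_zero _ m, fun m _ _ => by simpa using oddRelation_one _ m⟩
  | succ k ih =>
    obtain ⟨ih0, ih1⟩ := ih
    push_cast
    refine ⟨ih1, fun m h1 h2 => ?_⟩
    -- The divisors `T (m + k + 1)` and `T (m - k)` vanish at `m = -1 - k` and `m = k`.
    by_cases h3 : m = k
    · subst h3
      exact oddRelation_somosT_antisymm (ih0 _ (by omega) (by omega))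
    by_cases h4 : m = -1 - k
    · subst h4
      exact oddRelation_somosT_reflect
        (oddRelation_somosT_antisymm (ih0 (k + 1 + 1) (by omega) (by omega)))
    refine OddRelation.step hT hT (by omega) (by omega) (ih1 _ (by omega) (by omega))
      (ih1 _ (by omega) (by omega)) ?_ (mul_ne_zero ?_ ?_)
    · rw [add_sub_cancel_right]
      exact ih0 _ (by omega) (by omega)
    · exact somosT_ne_zero_of_abs h (by omega) (by omega) (by omega)
    · exact somosT_ne_zero_of_abs h (by omega) (by omega) (by omega)

/-! ### Duplication formulas and nonvanishing of `T` -/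

theorem somosT_even {N : ℤ} (h : ∀ n, 0 < n → n < N → somosT n ≠ 0) {k : ℤ} (h1 : 1 ≤ k)
    (h2 : 2 * k ≤ N) : somosT (2 * k) = -(somosT k *
      (somosT (k + 2) * somosT (k - 1) ^ 2 - somosT (k - 2) * somosT (k + 1) ^ 2)) := by
  obtain ⟨l, rfl⟩ : ∃ l : ℕ, k = l + 1 := ⟨(k - 1).toNat, by omega⟩
  -- The left side of this relation is `T (2 * k) * T 1`.
  have e := (oddRelation_somosT_of_window h l).1 (l + 1) (by omega) (by omega)
  unfold OddRelation at e
  ring_nf at e ⊢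
  rw [somosT_one] at e
  linear_combination e

theorem somosT_odd {N : ℤ} (h : ∀ n, 0 < n → n < N → somosT n ≠ 0) {k : ℤ} (h1 : 1 ≤ k)
    (h2 : 2 * k + 1 ≤ N) : somosT (2 * k + 1) =
      somosT (k - 1) * somosT k ^ 2 * somosT (k + 3)
        - somosT (k - 2) * somosT (k + 1) ^ 2 * somosT (k + 2) := by
  obtain ⟨l, rfl⟩ : ∃ l : ℕ, k = l + 1 := ⟨(k - 1).toNat, by omega⟩
  -- The left side of this relation is `T (2 * k + 1) * T 2`.
  have e := (oddRelation_somosT_of_window h l).1 (l + 2) (by omega) (by omega)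
  unfold OddRelation at e
  ring_nf at e ⊢
  rw [somosT_two] at e
  linear_combination -e

/-- The values of `somosT` modulo `7`. -/
def somosTModSeven : ZMod 20 → ZMod 7 :=
  ![0, 1, 6, 1, 1, 0, 1, 6, 6, 6, 0, 1, 1, 1, 6, 0, 6, 6, 1, 6]

/-- The values of `somosT` modulo `2`. -/
def somosTModTwo : ZMod 6 → ZMod 2 := ![0, 1, 1, 1, 1, 1]

theorem somosTModSeven_even (k : ZMod 20) : somosTModSeven (2 * k) =
    -(somosTModSeven k * (somosTModSeven (k + 2) * somosTModSeven (k - 1) ^ 2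
      - somosTModSeven (k - 2) * somosTModSeven (k + 1) ^ 2)) := by
  revert k; decide

/-- `T k` may vanish modulo 7, but its cofactor in `T (2 * k)` never does, so `T k ≠ 0` implies `T
(2 * k) ≠ 0`. -/
theorem somosTModSeven_factor_ne_zero (k : ZMod 20) :
    somosTModSeven (k + 2) * somosTModSeven (k - 1) ^ 2
      - somosTModSeven (k - 2) * somosTModSeven (k + 1) ^ 2 ≠ 0 := by
  revert k; decide

theorem somosTModSeven_odd (k : ZMod 20) : somosTModSeven (2 * k + 1) =
    somosTModSeven (k - 1) * somosTModSeven k ^ 2 * somosTModSeven (k + 3)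
      - somosTModSeven (k - 2) * somosTModSeven (k + 1) ^ 2 * somosTModSeven (k + 2) := by
  revert k; decide

theorem somosTModTwo_even (k : ZMod 6) : somosTModTwo (2 * k) =
    -(somosTModTwo k * (somosTModTwo (k + 2) * somosTModTwo (k - 1) ^ 2
      - somosTModTwo (k - 2) * somosTModTwo (k + 1) ^ 2)) := by
  revert k; decide

theorem somosTModTwo_odd (k : ZMod 6) : somosTModTwo (2 * k + 1) =
    somosTModTwo (k - 1) * somosTModTwo k ^ 2 * somosTModTwo (k + 3)
      - somosTModTwo (k - 2) * somosTModTwo (k + 1) ^ 2 * somosTModTwo (k + 2) := by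
  revert k; decide

theorem somosTModTwo_two_mul_add_one (k : ZMod 6) : somosTModTwo (2 * k + 1) ≠ 0 := by
  revert k; decide

theorem exists_int_somosT (n : ℕ) : (∃ z : ℤ, somosT n = z ∧ (z : ZMod 7) = somosTModSeven n ∧
    (z : ZMod 2) = somosTModTwo n) ∧ (n ≠ 0 → somosT n ≠ 0) := by
  induction n using Nat.strong_induction_on with
  | _ n ih =>
    -- From `n = 7` on, all indices in the duplication formula lie in `[0, n)`.
    rcases lt_or_ge n 7 with hn | hn
    · interval_cases n
      · exact ⟨⟨0, by simp [somosT_zero], by decide, by decide⟩, by simp⟩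
      · exact ⟨⟨1, by simp [somosT_one], by decide, by decide⟩, by simp [somosT_one]⟩
      · exact ⟨⟨-1, by simp [somosT_two], by decide, by decide⟩, by simp [somosT_two]⟩
      · exact ⟨⟨1, by simp [somosT_three], by decide, by decide⟩, by simp [somosT_three]⟩
      · exact ⟨⟨1, by simp [somosT_four], by decide, by decide⟩, by simp [somosT_four]⟩
      · exact ⟨⟨-7, by simp [somosT_five], by decide, by decide⟩, by simp [somosT_five]⟩
      · exact ⟨⟨8, by simp [somosT_six], by decide, by decide⟩, by simp [somosT_six]⟩
    have hN : ∀ i : ℤ, 0 < i → i < n → somosT i ≠ 0 := fun i h1 h2 => by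
      lift i to ℕ using h1.le
      exact (ih i (by omega)).2 (by omega)
    have hz : ∀ i : ℤ, 0 ≤ i → i < n → ∃ z : ℤ, somosT i = z ∧
        (z : ZMod 7) = somosTModSeven i ∧ (z : ZMod 2) = somosTModTwo i := fun i h1 h2 => by
      lift i to ℕ using h1
      simpa using (ih i (by omega)).1
    obtain ⟨k, hk | hk⟩ : ∃ k : ℤ, (n : ℤ) = 2 * k ∨ (n : ℤ) = 2 * k + 1 := ⟨n / 2, by omega⟩
    all_goals
      obtain ⟨a, ha, ha7, ha2⟩ := hz (k - 2) (by omega) (by omega)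
      obtain ⟨b, hb, hb7, hb2⟩ := hz (k - 1) (by omega) (by omega)
      obtain ⟨c, hc, hc7, hc2⟩ := hz k (by omega) (by omega)
      obtain ⟨d, hd, hd7, hd2⟩ := hz (k + 1) (by omega) (by omega)
      obtain ⟨e, he, he7, he2⟩ := hz (k + 2) (by omega) (by omega)
      push_cast at ha7 ha2 hb7 hb2 hd7 hd2 he7 he2
      have n20 : ((n : ℕ) : ZMod 20) = ((n : ℤ) : ZMod 20) := (Int.cast_natCast n).symm
      have n6 : ((n : ℕ) : ZMod 6) = ((n : ℤ) : ZMod 6) := (Int.cast_natCast n).symm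
      rw [hk] at n20 n6
      push_cast at n20 n6
    · have hn2 := somosT_even hN (k := k) (by omega) (by omega)
      rw [ha, hb, hc, hd, he] at hn2
      rw [n20, n6, hk]
      refine ⟨⟨-(c * (e * b ^ 2 - a * d ^ 2)), by rw [hn2]; push_cast; ring, ?_, ?_⟩, fun _ => ?_⟩
      · push_cast
        rw [ha7, hb7, hc7, hd7, he7, somosTModSeven_even]
      · push_cast
        rw [ha2, hb2, hc2, hd2, he2, somosTModTwo_even]
      · rw [hn2]
        refine neg_ne_zero.mpr (mul_ne_zero (hc ▸ hN k (by omega) (by omega)) fun h => ?_)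
        have h' : e * b ^ 2 - a * d ^ 2 = 0 := by exact_mod_cast h
        apply somosTModSeven_factor_ne_zero k
        rw [← ha7, ← hb7, ← hd7, ← he7]
        exact_mod_cast congrArg (Int.cast : ℤ → ZMod 7) h'
    · obtain ⟨f, hf, hf7, hf2⟩ := hz (k + 3) (by omega) (by omega)
      push_cast at hf7 hf2
      have hn2 := somosT_odd hN (k := k) (by omega) (by omega)
      rw [ha, hb, hc, hd, he, hf] at hn2
      rw [n20, n6, hk]
      have hmod : ((b * c ^ 2 * f - a * d ^ 2 * e : ℤ) : ZMod 2) = somosTModTwo (2 * k + 1) := by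
        push_cast
        rw [ha2, hb2, hc2, hd2, he2, hf2, somosTModTwo_odd]
      refine ⟨⟨b * c ^ 2 * f - a * d ^ 2 * e, by rw [hn2]; push_cast; ring, ?_, hmod⟩, fun _ => ?_⟩
      · push_cast
        rw [ha7, hb7, hc7, hd7, he7, hf7, somosTModSeven_odd]
      · rw [hn2]
        intro h
        have h' : b * c ^ 2 * f - a * d ^ 2 * e = 0 := by exact_mod_cast h
        apply somosTModTwo_two_mul_add_one k
        rw [← hmod, h', Int.cast_zero]

theorem somosT_ne_zero {n : ℤ} (h : n ≠ 0) : somosT n ≠ 0 := by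
  refine somosT_ne_zero_of_abs (N := |n| + 1) (fun i h1 _ => ?_) h
    (by have := neg_abs_le n; omega) (by have := le_abs_self n; omega)
  lift i to ℕ using h1.le
  exact (exists_int_somosT i).2 (by omega)

theorem somosOn_somosT_top (N : ℤ) : SomosOn somosT 1 6 N := by
  have := somosOn_somosT (N := N - 3) fun n h _ => somosT_ne_zero h.ne'
  simpa using this

theorem oddRelation_somosT (j m : ℤ) : OddRelation somosT j m := by
  have key : ∀ (k : ℕ) (m : ℤ), OddRelation somosT k m := fun k m =>
    (oddRelation_somosT_of_window (N := |m| + k + 1) (fun n h _ => somosT_ne_zero h.ne') k).1 m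
      (by have := neg_abs_le m; omega) (by have := le_abs_self m; omega)
  rcases le_or_gt 0 j with hj | hj
  · lift j to ℕ using hj
    exact key j m
  · have := (key (-1 - j).toNat m).reflect_index
    rwa [Int.toNat_of_nonneg (by omega), sub_sub_cancel] at this

theorem oddRelation_of_ne_zero {X : ℤ → ℚ} {α β : ℚ} (hX : ∀ N, SomosOn X α β N)
    (h0 : ∀ n, X n ≠ 0) (j m : ℤ) : OddRelation X j m := by
  have key : ∀ k : ℕ, (∀ m, OddRelation X k m) ∧ ∀ m, OddRelation X (k + 1) m := by
    intro k
    induction k with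
    | zero => exact ⟨oddRelation_zero X, fun m => by simpa using oddRelation_one X m⟩
    | succ k ih =>
      push_cast
      refine ⟨ih.2, fun m => OddRelation.step (somosOn_somosT_top (k + 4)) (hX (|m| + 3))
        (by omega) ?_ (ih.2 _) (ih.2 _) ?_ (mul_ne_zero (h0 _) (h0 _))⟩
      · have := neg_abs_le m
        have := le_abs_self m
        omega
      · rw [add_sub_cancel_right]
        exact ih.1 m
  rcases le_or_gt 0 j with hj | hj
  · lift j to ℕ using hj
    exact (key j).1 m
  · have := ((key (-1 - j).toNat).1 m).reflect_index
    rwa [Int.toNat_of_nonneg (by omega), sub_sub_cancel] at this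

/-! ### Products with even index sum -/

/-- The relation expressing the product `X_{m+r} X_{m-r}` through `X_{m+1} X_{m-1}` and
`X_m ^ 2`. -/
def EvenRelation (X : ℤ → ℚ) (α β : ℚ) (r m : ℤ) : Prop :=
  X (m + r) * X (m - r) =
    (if Even r then alternating α β m else 1) * somosT r ^ 2 * (X (m + 1) * X (m - 1))
      - (if Even r then 1 else alternating α β (m + 1)) * (somosT (r + 1) * somosT (r - 1))
        * X m ^ 2

theorem evenRelation_iff_of_even {X : ℤ → ℚ} {α β : ℚ} {r m : ℤ} (hr : Even r) :
    EvenRelation X α β r m ↔ X (m + r) * X (m - r) =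
      alternating α β m * somosT r ^ 2 * (X (m + 1) * X (m - 1))
        - somosT (r + 1) * somosT (r - 1) * X m ^ 2 := by
  simp [EvenRelation, hr]

theorem evenRelation_iff_of_odd {X : ℤ → ℚ} {α β : ℚ} {r m : ℤ} (hr : Odd r) :
    EvenRelation X α β r m ↔ X (m + r) * X (m - r) =
      somosT r ^ 2 * (X (m + 1) * X (m - 1))
        - alternating α β (m + 1) * (somosT (r + 1) * somosT (r - 1)) * X m ^ 2 := by
  simp [EvenRelation, Int.not_even_iff_odd.mpr hr]

theorem evenRelation_zero (X : ℤ → ℚ) (α β : ℚ) (m : ℤ) : EvenRelation X α β 0 m := by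
  rw [evenRelation_iff_of_even (by simp)]
  norm_num [somosT_neg, somosT_zero, somosT_one, sq]

theorem evenRelation_one (X : ℤ → ℚ) (α β : ℚ) (m : ℤ) : EvenRelation X α β 1 m := by
  rw [evenRelation_iff_of_odd (by simp)]
  norm_num [somosT_zero, somosT_one]

/-- The same quotient argument; `a * b = 6` matches the coefficients `1` and `6` of `T`. -/
theorem evenRelation_step_algebra_even {u₀ u₁ u₂ u₃ u₄ t₀ t₁ t₂ t₃ t₄ p q r s a b : ℚ}
    (hab : a * b = 6) (u4 : u₄ * u₀ = a * u₃ * u₁ - u₂ ^ 2)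
    (uc : u₄ * u₁ ^ 2 + u₀ * u₃ ^ 2 = 5 * u₃ * u₂ * u₁ - b * u₂ ^ 3)
    (t4 : t₄ * t₀ = 1 * t₃ * t₁ - t₂ ^ 2)
    (tc : t₄ * t₁ ^ 2 + t₀ * t₃ ^ 2 = 5 * t₃ * t₂ * t₁ - 6 * t₂ ^ 3)
    (h1 : p * q = b * t₂ ^ 2 * (u₄ * u₂) - t₃ * t₁ * u₃ ^ 2)
    (h2 : r * s = b * t₂ ^ 2 * (u₂ * u₀) - t₃ * t₁ * u₁ ^ 2)
    (h3 : r * q = t₁ ^ 2 * (u₃ * u₁) - b * (t₂ * t₀) * u₂ ^ 2) (h0 : r * q ≠ 0) :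
    p * s = t₃ ^ 2 * (u₃ * u₁) - b * (t₄ * t₂) * u₂ ^ 2 := by
  apply mul_right_cancel₀ h0
  linear_combination r * s * h1 + (b * t₂ ^ 2 * (u₄ * u₂) - t₃ * t₁ * u₃ ^ 2) * h2
    - (t₃ ^ 2 * (u₃ * u₁) - b * (t₄ * t₂) * u₂ ^ 2) * h3
    + b ^ 2 * t₂ ^ 4 * u₂ ^ 2 * u4 - b * t₂ ^ 2 * t₃ * t₁ * u₂ * uc
    + b * t₂ * u₃ * u₁ * u₂ ^ 2 * tc - b ^ 2 * t₂ ^ 2 * u₂ ^ 4 * t4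
    + b * t₂ ^ 4 * u₃ * u₁ * u₂ ^ 2 * hab

theorem evenRelation_step_algebra_odd {u₀ u₁ u₂ u₃ u₄ t₀ t₁ t₂ t₃ t₄ p q r s a b : ℚ}
    (hab : a * b = 6) (u4 : u₄ * u₀ = a * u₃ * u₁ - u₂ ^ 2)
    (uc : u₄ * u₁ ^ 2 + u₀ * u₃ ^ 2 = 5 * u₃ * u₂ * u₁ - b * u₂ ^ 3)
    (t4 : t₄ * t₀ = 6 * t₃ * t₁ - t₂ ^ 2)
    (tc : t₄ * t₁ ^ 2 + t₀ * t₃ ^ 2 = 5 * t₃ * t₂ * t₁ - 1 * t₂ ^ 3)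
    (h1 : p * q = t₂ ^ 2 * (u₄ * u₂) - a * (t₃ * t₁) * u₃ ^ 2)
    (h2 : r * s = t₂ ^ 2 * (u₂ * u₀) - a * (t₃ * t₁) * u₁ ^ 2)
    (h3 : r * q = a * t₁ ^ 2 * (u₃ * u₁) - t₂ * t₀ * u₂ ^ 2) (h0 : r * q ≠ 0) :
    p * s = a * t₃ ^ 2 * (u₃ * u₁) - t₄ * t₂ * u₂ ^ 2 := by
  apply mul_right_cancel₀ h0
  linear_combination r * s * h1 + (t₂ ^ 2 * (u₄ * u₂) - a * (t₃ * t₁) * u₃ ^ 2) * h2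
    - (a * t₃ ^ 2 * (u₃ * u₁) - t₄ * t₂ * u₂ ^ 2) * h3
    + t₂ ^ 4 * u₂ ^ 2 * u4 - a * t₂ ^ 2 * t₃ * t₁ * u₂ * uc
    + a * t₂ * u₃ * u₁ * u₂ ^ 2 * tc - t₂ ^ 2 * u₂ ^ 4 * t4
    + t₂ ^ 2 * t₃ * t₁ * u₂ ^ 4 * hab

theorem alternating_mul_add_one (α β : ℚ) (m : ℤ) :
    alternating α β m * alternating α β (m + 1) = α * β := by
  rcases Int.even_or_odd m with h | h
  · rw [alternating_even h, alternating_odd h.add_one]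
  · rw [alternating_odd h, alternating_even h.add_one, mul_comm]

theorem SomosOn.four_top {X : ℤ → ℚ} {α β : ℚ} (hX : ∀ N, SomosOn X α β N) (m : ℤ) :
    X (m + 2) * X (m - 2) = alternating α β m * X (m + 1) * X (m - 1) - X m ^ 2 :=
  (hX (|m| + 2)).four m (by have := neg_abs_le m; omega) (by have := le_abs_self m; omega)

theorem SomosOn.cubic_top {X : ℤ → ℚ} {α β : ℚ} (hX : ∀ N, SomosOn X α β N) (m : ℤ) :
    X (m + 2) * X (m - 1) ^ 2 + X (m - 2) * X (m + 1) ^ 2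
      = 5 * X (m + 1) * X m * X (m - 1) - alternating α β (m + 1) * X m ^ 3 :=
  (hX (|m| + 2)).cubic m (by have := neg_abs_le m; omega) (by have := le_abs_self m; omega)

theorem EvenRelation.step {X : ℤ → ℚ} {α β : ℚ} {r m : ℤ} (hX : ∀ N, SomosOn X α β N)
    (hαβ : α * β = 6) (h1 : EvenRelation X α β r (m + 1)) (h2 : EvenRelation X α β r (m - 1))
    (h3 : EvenRelation X α β (r - 1) m) (h0 : X (m - 1 + r) * X (m + 1 - r) ≠ 0) :
    EvenRelation X α β (r + 1) m := by
  have hab : alternating α β m * alternating α β (m + 1) = 6 :=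
    (alternating_mul_add_one α β m).trans hαβ
  have u4 := SomosOn.four_top hX m
  have uc := SomosOn.cubic_top hX m
  have t4 := SomosOn.four_top somosOn_somosT_top r
  have tc := SomosOn.cubic_top somosOn_somosT_top r
  have ha : alternating α β (m + 1 + 1) = alternating α β m := by
    rw [add_assoc]; exact alternating_add_two α β m
  rcases Int.even_or_odd r with hr | hr
  · have hr' : Odd (r - 1) := by simpa using hr.sub_odd odd_one
    rw [evenRelation_iff_of_even hr] at h1 h2
    rw [evenRelation_iff_of_odd hr'] at h3
    rw [evenRelation_iff_of_odd hr.add_one]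
    rw [alternating_even hr] at t4
    rw [alternating_odd hr.add_one] at tc
    rw [alternating_sub_one] at h2
    have e := evenRelation_step_algebra_even (p := X (m + 1 + r)) (s := X (m - 1 - r)) hab u4 uc t4
      tc (by linear_combination (norm := ring_nf) h1) (by linear_combination (norm := ring_nf) h2)
      (by linear_combination (norm := ring_nf) h3) h0
    linear_combination (norm := ring_nf) e
  · have hr' : Even (r - 1) := by simpa using hr.sub_odd odd_one
    rw [evenRelation_iff_of_odd hr] at h1 h2
    rw [evenRelation_iff_of_even hr'] at h3
    rw [evenRelation_iff_of_even hr.add_one]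
    rw [alternating_odd hr] at t4
    rw [alternating_even hr.add_one] at tc
    rw [ha] at h1
    rw [sub_add_cancel] at h2
    have e := evenRelation_step_algebra_odd (p := X (m + 1 + r)) (s := X (m - 1 - r)) hab u4 uc t4
      tc (by linear_combination (norm := ring_nf) h1) (by linear_combination (norm := ring_nf) h2)
      (by linear_combination (norm := ring_nf) h3) h0
    linear_combination (norm := ring_nf) e

theorem EvenRelation.neg_index {X : ℤ → ℚ} {α β : ℚ} {r m : ℤ} (h : EvenRelation X α β r m) :
    EvenRelation X α β (-r) m := by
  unfold EvenRelation at *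
  rw [show -r + 1 = -(r - 1) by ring, show -r - 1 = -(r + 1) by ring, sub_neg_eq_add,
    ← sub_eq_add_neg]
  simp only [somosT_neg, even_neg]
  linear_combination h

theorem evenRelation_somosT_reflect {r m : ℤ} (h : EvenRelation somosT 1 6 r m) :
    EvenRelation somosT 1 6 r (-m) := by
  unfold EvenRelation at *
  have e : alternating 1 6 (-m + 1) = alternating 1 6 (m + 1) := by
    rw [show -m + 1 = -(m - 1) by ring, alternating_neg, alternating_sub_one]
  rw [e, alternating_neg, show -m + r = -(m - r) by ring, show -m - r = -(m + r) by ring,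
    show -m + 1 = -(m - 1) by ring, show -m - 1 = -(m + 1) by ring]
  simp only [somosT_neg]
  linear_combination h

/-- For equal parities the only alternating coefficient that occurs is `α = 1`, so both sides are
antisymmetric. -/
theorem evenRelation_somosT_antisymm {r m : ℤ} (hrm : Even r ↔ Even m)
    (h : EvenRelation somosT 1 6 r m) : EvenRelation somosT 1 6 m r := by
  have e := somosT_neg (m - r)
  rw [neg_sub] at e
  rcases Int.even_or_odd r with hr | hr
  · have hm := hrm.mp hr
    rw [evenRelation_iff_of_even hr, alternating_even hm] at h
    rw [evenRelation_iff_of_even hm, alternating_even hr, e, add_comm r m]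
    linear_combination -h
  · have hm : Odd m := Int.not_even_iff_odd.mp fun hm => Int.not_even_iff_odd.mpr hr (hrm.mpr hm)
    rw [evenRelation_iff_of_odd hr, alternating_even hm.add_one] at h
    rw [evenRelation_iff_of_odd hm, alternating_even hr.add_one, e, add_comm r m]
    linear_combination -h

theorem evenRelation_of_nat {X : ℤ → ℚ} {α β : ℚ}
    (h : ∀ (k : ℕ) (m : ℤ), EvenRelation X α β k m) (r m : ℤ) : EvenRelation X α β r m := by
  rcases le_total 0 r with hr | hr
  · lift r to ℕ using hr
    exact h r m
  · have := (h (-r).toNat m).neg_index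
    rwa [Int.toNat_of_nonneg (by omega), neg_neg] at this

theorem evenRelation_somosT (r m : ℤ) : EvenRelation somosT 1 6 r m := by
  refine evenRelation_of_nat (fun k => And.left (b := ∀ m, EvenRelation somosT 1 6 (k + 1) m) ?_)
    r m
  induction k with
  | zero => exact ⟨evenRelation_zero _ _ _, fun m => by simpa using evenRelation_one _ _ _ m⟩
  | succ k ih =>
    push_cast
    refine ⟨ih.2, fun m => ?_⟩
    have hp : Even (k : ℤ) ↔ Even ((k : ℤ) + 1 + 1) := by simp
    by_cases h3 : m = k
    · subst h3
      exact evenRelation_somosT_antisymm hp (ih.1 _)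
    by_cases h4 : m = -k
    · subst h4
      exact evenRelation_somosT_reflect (evenRelation_somosT_antisymm hp (ih.1 _))
    refine EvenRelation.step somosOn_somosT_top (by norm_num) (ih.2 _) (ih.2 _) ?_
      (mul_ne_zero (somosT_ne_zero (by omega)) (somosT_ne_zero (by omega)))
    rw [add_sub_cancel_right]
    exact ih.1 m

theorem evenRelation_of_ne_zero {X : ℤ → ℚ} {α β : ℚ} (hX : ∀ N, SomosOn X α β N)
    (hαβ : α * β = 6) (h0 : ∀ n, X n ≠ 0) (r m : ℤ) : EvenRelation X α β r m := by
  refine evenRelation_of_nat (fun k => And.left (b := ∀ m, EvenRelation X α β (k + 1) m) ?_) r m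
  induction k with
  | zero => exact ⟨evenRelation_zero _ _ _, fun m => by simpa using evenRelation_one _ _ _ m⟩
  | succ k ih =>
    push_cast
    refine ⟨ih.2, fun m => EvenRelation.step hX hαβ (ih.2 _) (ih.2 _) ?_
      (mul_ne_zero (h0 _) (h0 _))⟩
    rw [add_sub_cancel_right]
    exact ih.1 m

/-! ### Three-term relations and vanishing minors -/

theorem OddRelation.three_term {X : ℤ → ℚ} (hX : ∀ j m, OddRelation X j m) (m p q r : ℤ) :
    X (m + 1 + p) * X (m - p) * (somosT (q + 1 + r) * somosT (q - r))
      + X (m + 1 + q) * X (m - q) * (somosT (r + 1 + p) * somosT (r - p))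
      + X (m + 1 + r) * X (m - r) * (somosT (p + 1 + q) * somosT (p - q)) = 0 := by
  rw [hX p m, hX q m, hX r m, oddRelation_somosT r q, oddRelation_somosT p r,
    oddRelation_somosT q p]
  ring

theorem EvenRelation.three_term {X : ℤ → ℚ} {α β : ℚ} (hX : ∀ r m, EvenRelation X α β r m)
    (m : ℤ) {p q r : ℤ} (hpq : Even p ↔ Even q) (hpr : Even p ↔ Even r) :
    X (m + p) * X (m - p) * (somosT (q + r) * somosT (q - r))
      + X (m + q) * X (m - q) * (somosT (r + p) * somosT (r - p))
      + X (m + r) * X (m - r) * (somosT (p + q) * somosT (p - q)) = 0 := by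
  rcases Int.even_or_odd p with hp | hp
  · have hq := hpq.mp hp
    have hr := hpr.mp hp
    rw [(evenRelation_iff_of_even hp).mp (hX p m), (evenRelation_iff_of_even hq).mp (hX q m),
      (evenRelation_iff_of_even hr).mp (hX r m),
      (evenRelation_iff_of_even hr).mp (evenRelation_somosT r q),
      (evenRelation_iff_of_even hp).mp (evenRelation_somosT p r),
      (evenRelation_iff_of_even hq).mp (evenRelation_somosT q p),
      alternating_even hp, alternating_even hq, alternating_even hr]
    ring
  · have hq : Odd q := Int.not_even_iff_odd.mp fun h => Int.not_even_iff_odd.mpr hp (hpq.mpr h)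
    have hr : Odd r := Int.not_even_iff_odd.mp fun h => Int.not_even_iff_odd.mpr hp (hpr.mpr h)
    rw [(evenRelation_iff_of_odd hp).mp (hX p m), (evenRelation_iff_of_odd hq).mp (hX q m),
      (evenRelation_iff_of_odd hr).mp (hX r m),
      (evenRelation_iff_of_odd hr).mp (evenRelation_somosT r q),
      (evenRelation_iff_of_odd hp).mp (evenRelation_somosT p r),
      (evenRelation_iff_of_odd hq).mp (evenRelation_somosT q p),
      alternating_even hp.add_one, alternating_even hq.add_one, alternating_even hr.add_one]
    ring

/-- The coefficient of a row `a` in the linear relation between the rows `a`, `b`, `c` of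
`somosMatrix X n`. -/
def rowCoeff (X : ℤ → ℚ) (n b c : ℤ) : ℚ := X (n + 2 * b + 2 * c) * somosT (2 * b - 2 * c)

/-- The indices `n + 2 * a + j` and `n + 2 * b + 2 * c` have a sum symmetric in `a`, `b`, `c`, so
the three products share a centre. The parity of `j` selects the three-term relation. -/
theorem somosMatrix_rows_dependent {X : ℤ → ℚ} {α β : ℚ} (hodd : ∀ j m, OddRelation X j m)
    (heven : ∀ r m, EvenRelation X α β r m) (n a b c j : ℤ) :
    rowCoeff X n b c * somosMatrix X n a j + rowCoeff X n c a * somosMatrix X n b j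
      + rowCoeff X n a b * somosMatrix X n c j = 0 := by
  simp only [rowCoeff, somosMatrix, Matrix.of_apply]
  obtain ⟨l, rfl | rfl⟩ := Int.even_or_odd' j
  · have e := EvenRelation.three_term heven (n + a + b + c + l) (p := a + l - b - c)
      (q := b + l - c - a) (r := c + l - a - b)
      (by simp only [Int.even_add, Int.even_sub]; tauto)
      (by simp only [Int.even_add, Int.even_sub]; tauto)
    ring_nf at e ⊢
    linear_combination e
  · have e := OddRelation.three_term hodd (n + a + b + c + l) (a + l - b - c) (b + l - c - a)
      (c + l - a - b)
    ring_nf at e ⊢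
    linear_combination e

theorem somosMatrix_minor_eq_zero {X : ℤ → ℚ} {α β : ℚ} (hodd : ∀ j m, OddRelation X j m)
    (heven : ∀ r m, EvenRelation X α β r m) (h0 : ∀ n, n ≠ 0 → X n ≠ 0) (n : ℤ) {k : ℕ}
    (hk : 3 ≤ k) (r c : Fin k → ℤ) : ((somosMatrix X n).submatrix r c).det = 0 := by
  by_cases hr : Function.Injective r
  swap
  · obtain ⟨x, y, hxy, hne⟩ : ∃ x y, r x = r y ∧ x ≠ y := by
      simpa [Function.Injective] using hr
    exact Matrix.det_zero_of_row_eq hne (by ext j; simp [hxy])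
  let x : Fin k := ⟨0, by omega⟩
  let y : Fin k := ⟨1, by omega⟩
  let z : Fin k := ⟨2, by omega⟩
  have hxy : x ≠ y := by simp [x, y]
  have hxz : x ≠ z := by simp [x, z]
  have hyz : y ≠ z := by simp [y, z]
  have nxy := hr.ne hxy
  have nxz := hr.ne hxz
  have nyz := hr.ne hyz
  refine Matrix.exists_vecMul_eq_zero_iff.mp
    ⟨Pi.single x (rowCoeff X n (r y) (r z)) + Pi.single y (rowCoeff X n (r z) (r x))
      + Pi.single z (rowCoeff X n (r x) (r y)), fun h => ?_, ?_⟩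
  -- For distinct rows a coefficient can vanish only through `X 0`; two of them vanishing would make
  -- two rows equal.
  · have hz : rowCoeff X n (r x) (r y) = 0 := by
      simpa [hxz.symm, hyz.symm] using congrFun h z
    have hy : rowCoeff X n (r z) (r x) = 0 := by
      simpa [hxy.symm, hyz] using congrFun h y
    have key : ∀ {b c}, b ≠ c → rowCoeff X n b c = 0 → n + 2 * b + 2 * c = 0 := by
      intro b c hbc h
      by_contra hn
      exact mul_ne_zero (h0 _ hn) (somosT_ne_zero (by omega)) h
    have := key nxy hz
    have := key nxz.symm hy
    omega
  · ext j
    simpa [Matrix.add_vecMul] using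
      somosMatrix_rows_dependent hodd heven n (r x) (r y) (r z) (c j)

/-! ### Higher Somos relations and the 3×3 determinants -/

theorem higherSomos_of_oddRelation {X : ℤ → ℚ} (h : ∀ j m, OddRelation X j m) (j n : ℤ) :
    HigherSomos X j n := by
  have e := h j (n + j)
  unfold OddRelation at e
  unfold HigherSomos
  rw [somosT_one, somosT_two]
  linear_combination (norm := ring_nf) -e

theorem somosMatrixThree_det (X : ℤ → ℚ) (j n : ℤ) : (somosMatrixThree X j n).det =
    X (n + j - 1) * somosT j *
      (somosT j * somosT (j + 1) * X (n + j + 2) * X (n + j - 1)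
        - somosT (j - 1) * somosT (j + 2) * X (n + j + 1) * X (n + j)
        - somosT 1 * somosT 2 * X (n + 2 * j + 1) * X n) := by
  have h1 : somosT (-j + 1) = -somosT (j - 1) := by rw [← somosT_neg, neg_sub, neg_add_eq_sub]
  have h2 : somosT (-j - 1) = -somosT (j + 1) := by rw [← somosT_neg, neg_add']
  have h3 : somosT (-j - 2) = -somosT (j + 2) := by rw [← somosT_neg, neg_add']
  rw [somosMatrixThree, h1, h2, h3, Matrix.det_fin_three]
  simp [somosT_neg, somosT_zero, somosT_one, somosT_two]
  ring

theorem somosMatrixThree_det_eq_zero {X : ℤ → ℚ} {j n : ℤ} (h : HigherSomos X j n) :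
    (somosMatrixThree X j n).det = 0 := by
  unfold HigherSomos at h
  rw [somosMatrixThree_det, h]
  ring

theorem proposition2p1 :
    -- the two families of determinants vanish
    (∀ j n : ℤ, (somosMatrixThree somosS j n).det = 0) ∧
    (∀ j n : ℤ, (somosMatrixThree somosT j n).det = 0) ∧
    -- each determinant is a common factor times the defect of the higher Somos relation
    (∀ j n : ℤ, (somosMatrixThree somosS j n).det =
      somosS (n + j - 1) * somosT j *
        (somosT j * somosT (j + 1) * somosS (n + j + 2) * somosS (n + j - 1)
          - somosT (j - 1) * somosT (j + 2) * somosS (n + j + 1) * somosS (n + j)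
          - somosT 1 * somosT 2 * somosS (n + 2 * j + 1) * somosS n)) ∧
    (∀ j n : ℤ, (somosMatrixThree somosT j n).det =
      somosT (n + j - 1) * somosT j *
        (somosT j * somosT (j + 1) * somosT (n + j + 2) * somosT (n + j - 1)
          - somosT (j - 1) * somosT (j + 2) * somosT (n + j + 1) * somosT (n + j)
          - somosT 1 * somosT 2 * somosT (n + 2 * j + 1) * somosT n)) ∧
    -- vanishing is equivalent to the higher Somos relation
    (∀ j n : ℤ, (somosMatrixThree somosS j n).det = 0 ↔ HigherSomos somosS j n) ∧
    (∀ j n : ℤ, (somosMatrixThree somosT j n).det = 0 ↔ HigherSomos somosT j n) ∧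
    -- the higher Somos relations hold
    (∀ j n : ℤ, HigherSomos somosS j n) ∧
    (∀ j n : ℤ, HigherSomos somosT j n) ∧
    -- all minors of size at least three of the two infinite matrices vanish
    (∀ (n : ℤ) (k : ℕ), 3 ≤ k → ∀ r c : Fin k → ℤ,
      ((somosMatrix somosS n).submatrix r c).det = 0) ∧
    (∀ (n : ℤ) (k : ℕ), 3 ≤ k → ∀ r c : Fin k → ℤ,
      ((somosMatrix somosT n).submatrix r c).det = 0) := by
  have oddS := oddRelation_of_ne_zero somosOn_somosS somosS_ne_zero
  have evenS := evenRelation_of_ne_zero somosOn_somosS (by norm_num) somosS_ne_zero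
  have hS := higherSomos_of_oddRelation oddS
  have hT := higherSomos_of_oddRelation oddRelation_somosT
  exact ⟨fun j n => somosMatrixThree_det_eq_zero (hS j n),
    fun j n => somosMatrixThree_det_eq_zero (hT j n),
    somosMatrixThree_det somosS, somosMatrixThree_det somosT,
    -- The common factor vanishes for `j = 0`, so it cannot be cancelled; the equivalence holds
    -- because both sides are true.
    fun j n => ⟨fun _ => hS j n, somosMatrixThree_det_eq_zero⟩,
    fun j n => ⟨fun _ => hT j n, somosMatrixThree_det_eq_zero⟩, hS, hT,
    fun n k hk => somosMatrix_minor_eq_zero oddS evenS (fun m _ => somosS_ne_zero m) n hk,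
    fun n k hk => somosMatrix_minor_eq_zero oddRelation_somosT evenRelation_somosT
      (fun _ => somosT_ne_zero) n hk⟩
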